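/- Let $\ell:[0,\infty)\to[-\infty,\infty)$ and $r:[0,\infty)\to(-\infty,\infty]$ be right-continuous functions with left limits in $[-\infty,\infty)$ and $(-\infty,\infty]$, respectively, such that $\ell\le r$. Put $$\tau=\inf\{t>0:\ r(t)=\ell(t)\ \text{or}\ r(t-)=\ell(t-)\}$$ and assume $\tau\in(0,\infty)$. Let $B$ be a standard one-dimensional Brownian motion started at $0$ on a probability space, let $x\in\mathbb{R}$, and let $W$ be the reflected Brownian motion on $[\ell(\cdot),r(\cdot)]$ started at $x$, with local time $Y$. That is, $W$ and $Y$ are real-valued and, for almost every $\omega$, the pair $(\phi,\eta)=(W(\omega,\cdot),Y(\omega,\cdot))$ solves the extended Skorokhod problem on $[\ell(\cdot),r(\cdot)]$ for $\psi=x+B(\omega,\cdot)$: the functions $\psi,\phi,\eta$ are right-continuous with finite left limits, and 1. $\phi(t)=\psi(t)+\eta(t)\in[\ell(t),r(t)]$ for all $t\ge0$; 2. for all $0\le s\le t$: $\eta(t)-\eta(s)\ge0$ if $\phi(u)<r(u)$ for all $u\in(s,t]$, and $\eta(t)-\eta(s)\le0$ if $\phi(u)>\ell(u)$ for all $u\in(s,t]$;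 3. for all $t\ge0$: $\eta(t)-\eta(t-)\ge0$ if $\phi(t)<r(t)$, and $\eta(t)-\eta(t-)\le0$ if $\phi(t)>\ell(t)$, where $\eta(0-)=0$. Suppose that there are a strictly increasing sequence $(s_k)_{k\in\mathbb{Z}}$ with $\lim_{k\to-\infty}s_k=0$ and $\lim_{k\to\infty}s_k=\tau$, a constant $c_1\in(0,\infty)$, and real sequences $(a_k)_{k\in\mathbb{Z}}$, $(b_k)_{k\in\mathbb{Z}}$ such that, for every $k\in\mathbb{Z}$, $$\{(t,x): s_k<t<s_{k+1},\ a_k<x<b_k\}\subset\{(t,x):\ell(t)<x<r(t)\},$$ $$\frac1{c_1}(s_{k+1}-s_k)^{1/2}<b_k-a_k<c_1(s_{k+1}-s_k)^{1/2}.$$ Put $m_k=(a_k+b_k)/2$ and $$d_k=|r(s_k)-m_k|+|\ell(s_k)-m_k|,$$ $$d_k'=\max\bigl(|r(s_{k+1})-m_k|,\,|r(s_{k+1}-)-m_k|\bigr)+\max\bigl(|\ell(s_{k+1})-m_k|,\,|\ell(s_{k+1}-)-m_k|\bigr).$$ If $$\sum_{k\in\mathbb{Z}}(s_{k+1}-s_k)^{1/2}<\infty,\qquad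 \sum_{k\in\mathbb{Z}}d_k<\infty,\qquad \sum_{k\in\mathbb{Z}}d_k'<\infty,$$ then $\mathbb{E}\bigl[\mathcal{V}_{[0,\tau]}Y\bigr]<\infty$, where $\mathcal{V}_{[0,\tau]}Y$ denotes the total variation of $t\mapsto Y(t)$ on $[0,\tau]$. -/

import Mathlib

open Set Filter Topology MeasureTheory ProbabilityTheory
open scoped NNReal ENNReal

/-- `f : [0,∞) → E` is càdlàg with values in `V`: it is right continuous with left limits, and both
its values and its left limits lie in `V`. -/
structure IsCadlagIn {E : Type*} [TopologicalSpace E] (V : Set E) (f : ℝ≥0 → E) : Prop where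
  mem : ∀ t, f t ∈ V
  right_cont : ∀ t, ContinuousWithinAt f (Ici t) t
  left_lim : ∀ t, 0 < t → ∃ y ∈ V, Tendsto f (𝓝[<] t) (𝓝 y)

/-- Real-valued càdlàg functions on `[0,∞)`, with finite left limits. -/
def IsCadlagReal (f : ℝ≥0 → ℝ) : Prop := IsCadlagIn univ f

/-- Càdlàg functions on `[0,∞)` with values in `[-∞,∞)`. -/
def IsCadlagLower (f : ℝ≥0 → EReal) : Prop := IsCadlagIn (Iio ⊤) f

/-- Càdlàg functions on `[0,∞)` with values in `(-∞,∞]`. -/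
def IsCadlagUpper (f : ℝ≥0 → EReal) : Prop := IsCadlagIn (Ioi ⊥) f

/-- The value `η(t-)`, with the convention `η(0-) = 0`. -/
noncomputable def leftValue (η : ℝ≥0 → ℝ) (t : ℝ≥0) : ℝ :=
  if t = 0 then 0 else Function.leftLim η t

/-- `(φ, η)` solves the extended Skorokhod problem on `[ℓ(·), r(·)]` for `ψ`. -/
structure SolvesESP (ℓ r : ℝ≥0 → EReal) (ψ φ η : ℝ≥0 → ℝ) : Prop where
  cadlag_input : IsCadlagReal ψ
  cadlag_constrained : IsCadlagReal φ
  cadlag_constraining : IsCadlagReal η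
  decomp : ∀ t, φ t = ψ t + η t
  mem_interval : ∀ t, ℓ t ≤ (φ t : EReal) ∧ (φ t : EReal) ≤ r t
  nondecreasing : ∀ s t, s ≤ t → (∀ u ∈ Ioc s t, (φ u : EReal) < r u) → 0 ≤ η t - η s
  nonincreasing : ∀ s t, s ≤ t → (∀ u ∈ Ioc s t, ℓ u < (φ u : EReal)) → η t - η s ≤ 0
  jump_nonneg : ∀ t, (φ t : EReal) < r t → 0 ≤ η t - leftValue η t
  jump_nonpos : ∀ t, ℓ t < (φ t : EReal) → η t - leftValue η t ≤ 0

/-- `W` is the reflected Brownian motion on `[ℓ(·), r(·)]` started at `x` and driven by `B`, and `Y`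
is its local time: `W = x + B + Y`, and almost every path of `(W, Y)` solves the extended Skorokhod
problem for the corresponding path of `x + B`. -/
def IsRBMWithLocalTime {Ω : Type*} [MeasurableSpace Ω] (P : Measure Ω) (ℓ r : ℝ≥0 → EReal) (x : ℝ)
    (B W Y : ℝ≥0 → Ω → ℝ) : Prop :=
  ∀ᵐ ω ∂P, SolvesESP ℓ r (fun t => x + B t ω) (fun t => W t ω) (fun t => Y t ω)

/-- The positive times `t` at which `r(t) = ℓ(t)` or `r(t-) = ℓ(t-)`. -/
def contactTimes (ℓ r : ℝ≥0 → EReal) : Set ℝ≥0 :=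
  {t | 0 < t ∧ (r t = ℓ t ∨ Function.leftLim r t = Function.leftLim ℓ t)}

/-- The open space-time domain between the two boundaries. -/
def spaceTimeDomain (ℓ r : ℝ≥0 → EReal) : Set (ℝ≥0 × ℝ) :=
  {p | ℓ p.1 < (p.2 : EReal) ∧ (p.2 : EReal) < r p.1}

/-- The distance `|y - m|`, in `[0,∞]`, from an extended real `y` to a real number `m`. -/
noncomputable def devFrom (m : ℝ) (y : EReal) : ℝ≥0∞ := (y - (m : EReal)).abs

/-- `d = |r(s) - m| + |ℓ(s) - m|`, the deviation of the boundaries from `m` at time `s`. -/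
noncomputable def boundaryDev (ℓ r : ℝ≥0 → EReal) (m : ℝ) (s : ℝ≥0) : ℝ≥0∞ :=
  devFrom m (r s) + devFrom m (ℓ s)

/-- `d' = |r(s) - m| ∨ |r(s-) - m| + |ℓ(s) - m| ∨ |ℓ(s-) - m|`, the deviation from `m` at time `s`
that also takes the left limits of the boundaries into account. -/
noncomputable def boundaryDevLeft (ℓ r : ℝ≥0 → EReal) (m : ℝ) (s : ℝ≥0) : ℝ≥0∞ :=
  max (devFrom m (r s)) (devFrom m (Function.leftLim r s)) +
    max (devFrom m (ℓ s)) (devFrom m (Function.leftLim ℓ s))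

/-! Inside one box, of duration `Δ` and width at least `√Δ / c₁`, the lower boundary lies below the
box and the upper one above it. So `η` can increase only while `φ ≤ a` and decrease only while `φ ≥
b`. To switch from one kind of push to the other, the path must cross the box, and the driving path
must supply that crossing. Cut the box into `J` equal time pieces on which `ψ` oscillates by less
than half the width: on each piece `η` is monotone, so its variation there is just an increment.
That increment is at most `2D + 3O`, where `O` is the total oscillation of `ψ` and `D` the distance
from `φ(s)` to the midpoint (`eVariationOn_Icc_le_of_box`).

By Brownian scaling, the path in the box is `√Δ` times a standard path on `[0, 1]`, for which `J`
and `J * O` are bounded by a constant times one plus a dyadic Hölder energy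
(`exists_oscillation_bound`). The energy has the same finite mean in every box
(`lintegral_dyadicEnergy`). Since `D` is bounded by the deterministic `d_k`, no independence is
needed: the mean variation over the box is at most a constant times `d_k + √Δ`, plus `2 d_k'` for a
jump at its right end. These bounds are summable. Only the jump at `τ` remains, and a deterministic
constant bounds it (`exists_edist_left_lim_le`). -/

/-! ### One-sided pushing and the variation inside one box. -/

/-- On `[s, t)`, the function `η` can only decrease (continuously or by a jump) while `φ > a`. -/
structure DecreasesAbove (φ η : ℝ≥0 → ℝ) (a : ℝ) (s t : ℝ≥0) : Prop where
  le_of_forall_lt : ∀ u v, s ≤ u → u ≤ v → v < t → (∀ z ∈ Ioc u v, a < φ z) → η v ≤ η u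
  le_left_lim : ∀ z, s < z → z < t → ∃ y, Tendsto η (𝓝[<] z) (𝓝 y) ∧ (a < φ z → η z ≤ y)

lemma DecreasesAbove.mono_left {φ η : ℝ≥0 → ℝ} {a : ℝ} {s s' t : ℝ≥0}
    (h : DecreasesAbove φ η a s t) (hs : s ≤ s') : DecreasesAbove φ η a s' t where
  le_of_forall_lt u v hu := h.le_of_forall_lt u v (hs.trans hu)
  le_left_lim z hz := h.le_left_lim z (hs.trans_lt hz)

/-- The constrained path exceeds neither its starting point nor the level above which it can only be
pushed down by more than the oscillation of the driving path. -/
lemma DecreasesAbove.le_max_add {ψ φ η : ℝ≥0 → ℝ} {a O : ℝ} {s t q : ℝ≥0}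
    (h : DecreasesAbove φ η a s t) (hdec : ∀ z, φ z = ψ z + η z) (hψ : Continuous ψ)
    (hO : ∀ u ∈ Icc s q, ∀ v ∈ Icc s q, |ψ u - ψ v| ≤ O) (hsq : s ≤ q) (hqt : q < t) :
    φ q ≤ max (φ s) a + O := by
  -- Compare with the last time `σ` at which `φ ≤ M`: after `σ` the path is above `a`, so `η` does
  -- not increase and only `ψ` can raise `φ`.
  set M := max (φ s) a with hM
  set S := {u ∈ Icc s q | φ u ≤ M} with hS
  have hsS : s ∈ S := ⟨⟨le_rfl, hsq⟩, le_max_left _ _⟩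
  have hbdd : BddAbove S := ⟨q, fun u hu => hu.1.2⟩
  set σ := sSup S with hσ
  have hsσ : s ≤ σ := le_csSup hbdd hsS
  have hσq : σ ≤ q := csSup_le ⟨s, hsS⟩ fun u hu => hu.1.2
  have habove : ∀ z ∈ Ioc σ q, a < φ z := by
    intro z hz
    by_contra hcon
    have : z ∈ S := ⟨⟨hsσ.trans hz.1.le, hz.2⟩, (not_lt.1 hcon).trans (le_max_right _ _)⟩
    exact absurd (le_csSup hbdd this) (not_le.2 hz.1)
  -- The supremum need not be attained. If `φ σ > M ≥ a`, the jump of `η` at `σ` would be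
  -- nonpositive, while the left limit of `φ` is at most `M`: a contradiction.
  have key : φ σ ≤ M := by
    by_contra hcon
    have hσS : σ ∉ S := fun hh => hcon hh.2
    have hlt : s < σ := lt_of_le_of_ne hsσ fun hh => hσS (hh ▸ hsS)
    obtain ⟨y, hy, hle⟩ := h.le_left_lim σ hlt (hσq.trans_lt hqt)
    have hfreq : ∃ᶠ z in 𝓝[<] σ, z ∈ S := by
      have h1 : ∃ᶠ z in 𝓝[≤] σ, z ∈ S := (isLUB_csSup ⟨s, hsS⟩ hbdd).frequently_mem ⟨s, hsS⟩
      rw [← Iio_insert, nhdsWithin_insert, frequently_sup] at h1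
      rcases h1 with h1 | h1
      · exact absurd (by simpa using h1) hσS
      · exact h1
    have hφ : Tendsto φ (𝓝[<] σ) (𝓝 (ψ σ + y)) := by
      have : φ = fun z => ψ z + η z := funext hdec
      rw [this]
      exact ((hψ.tendsto σ).mono_left nhdsWithin_le_nhds).add hy
    have h2 : ψ σ + y ≤ M :=
      le_of_tendsto_of_frequently hφ (hfreq.mono fun z hz => hz.2)
    have h3 := hle (lt_of_le_of_lt (le_max_right _ _) (not_le.1 hcon))
    have h4 := hdec σ
    linarith
  have h1 := h.le_of_forall_lt σ q hsσ hσq hqt habove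
  have h2 := hO q ⟨hsq, le_rfl⟩ σ ⟨hsσ, hσq⟩
  have h3 := hdec σ
  have h4 := hdec q
  have h5 := (abs_le.1 h2).2
  linarith

/-- Reflection `x ↦ -x` of `DecreasesAbove.le_max_add`; the upper boundary is always handled through
`-φ`, `-η`, `-b`. -/
lemma DecreasesAbove.min_sub_le {ψ φ η : ℝ≥0 → ℝ} {b O : ℝ} {s t q : ℝ≥0}
    (h : DecreasesAbove (-φ) (-η) (-b) s t) (hdec : ∀ z, φ z = ψ z + η z) (hψ : Continuous ψ)
    (hO : ∀ u ∈ Icc s q, ∀ v ∈ Icc s q, |ψ u - ψ v| ≤ O) (hsq : s ≤ q) (hqt : q < t) :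
    min (φ s) b - O ≤ φ q := by
  have := h.le_max_add (ψ := -ψ) (fun z => by simp [hdec]; ring) hψ.neg
    (fun u hu v hv => by
      rw [Pi.neg_apply, Pi.neg_apply, neg_sub_neg, abs_sub_comm]; exact hO u hu v hv) hsq hqt
  simp only [Pi.neg_apply, max_neg_neg] at this
  linarith

lemma eVariationOn_Icc_le_of_antitoneOn_or_monotoneOn {η : ℝ≥0 → ℝ} {u v : ℝ≥0} {C : ℝ}
    (huv : u ≤ v) (h : AntitoneOn η (Icc u v) ∨ MonotoneOn η (Icc u v)) (hC : |η v - η u| ≤ C) :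
    eVariationOn η (Icc u v) ≤ ENNReal.ofReal C := by
  have hu : u ∈ Icc u v := ⟨le_rfl, huv⟩
  have hv : v ∈ Icc u v := ⟨huv, le_rfl⟩
  rcases h with h | h
  · have h1 : MonotoneOn (-η) (Icc u v) := h.neg
    have h2 := h1.eVariationOn_eq hu hv
    rw [inter_self] at h2
    have h3 : eVariationOn η (Icc u v) = eVariationOn (-η) (Icc u v) := by
      simp only [eVariationOn, Pi.neg_apply, edist_neg_neg]
    rw [h3, h2]
    apply ENNReal.ofReal_le_ofReal
    have := (abs_le.1 hC).1
    simp only [Pi.neg_apply]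
    linarith
  · have h2 := h.eVariationOn_eq hu hv
    rw [inter_self] at h2
    rw [h2]
    exact ENNReal.ofReal_le_ofReal ((abs_le.1 hC).2)

/-- If the driving path oscillates by less than half the width of the box on each of `J` pieces of
equal length, then the constraining path is monotone on each piece, which bounds its variation. -/
lemma eVariationOn_Icc_le_of_box {ψ φ η : ℝ≥0 → ℝ} {a b O D ε : ℝ} {s t v : ℝ≥0} {J : ℕ}
    (hdown : DecreasesAbove φ η a s t) (hup : DecreasesAbove (-φ) (-η) (-b) s t)
    (hdec : ∀ z, φ z = ψ z + η z) (hψ : Continuous ψ) (hJ : 0 < J) (hε : 2 * ε < b - a)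
    (hε0 : 0 ≤ ε)
    (hO : ∀ u ∈ Icc s t, ∀ v ∈ Icc s t, |ψ u - ψ v| ≤ O)
    (hfine : ∀ u ∈ Icc s t, ∀ v ∈ Icc s t, |(u : ℝ) - v| ≤ ((t : ℝ) - s) / J → |ψ u - ψ v| ≤ ε)
    (hD : |φ s - (a + b) / 2| ≤ D) (hsv : s ≤ v) (hvt : v < t) :
    eVariationOn η (Icc s v) ≤ J * ENNReal.ofReal (2 * D + 3 * O) := by
  have hst : s ≤ t := hsv.trans hvt.le
  have hD0 : 0 ≤ D := (abs_nonneg _).trans hD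
  have hglob : ∀ u, s ≤ u → u < t → |φ u - (a + b) / 2| ≤ D + O := by
    intro u hu hut
    have hOu : ∀ x ∈ Icc s u, ∀ y ∈ Icc s u, |ψ x - ψ y| ≤ O := fun x hx y hy =>
      hO x ⟨hx.1, hx.2.trans hut.le⟩ y ⟨hy.1, hy.2.trans hut.le⟩
    have h1 := hdown.le_max_add hdec hψ hOu hu hut
    have h2 := hup.min_sub_le hdec hψ hOu hu hut
    have h3 := abs_le.1 hD
    have h4 : max (φ s) a ≤ (a + b) / 2 + D := max_le (by linarith) (by linarith)
    have h5 : (a + b) / 2 - D ≤ min (φ s) b := le_min (by linarith) (by linarith)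
    exact abs_le.2 ⟨by linarith, by linarith⟩
  have hJ' : (0 : ℝ≥0) < J := by exact_mod_cast hJ
  -- The grid divides `[s, v]` with `v < t`, because the boundaries are not controlled at `t`; its
  -- mesh is still at most `(t - s) / J`.
  set I : ℕ → ℝ≥0 := fun i => s + (v - s) * (i / J) with hI
  have hImono : Monotone I := fun i j hij => by
    simp only [hI]
    gcongr
  have hI0 : I 0 = s := by simp [hI]
  have hIJ : I J = v := by
    simp only [hI]
    rw [div_self hJ'.ne', mul_one, add_tsub_cancel_of_le hsv]
  have hpiece : ∀ i ∈ Finset.range J,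
      eVariationOn η (Icc (I i) (I (i + 1))) ≤ ENNReal.ofReal (2 * D + 3 * O) := by
    intro i hi
    have hi' : i + 1 ≤ J := Finset.mem_range.1 hi
    have hsI : s ≤ I i := hI0 ▸ hImono (Nat.zero_le i)
    have hII : I i ≤ I (i + 1) := hImono (Nat.le_succ i)
    have hIv : I (i + 1) ≤ v := hIJ ▸ hImono hi'
    have hlen : (I (i + 1) : ℝ) - I i ≤ ((t : ℝ) - s) / J := by
      simp only [hI]
      push_cast [NNReal.coe_sub hsv]
      have : (0 : ℝ) < J := by exact_mod_cast hJ
      have h2 : (v : ℝ) < t := by exact_mod_cast hvt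
      rw [le_div_iff₀ this]
      field_simp
      linarith
    have hosc : ∀ z ∈ Icc (I i) (I (i + 1)), ∀ x ∈ Icc (I i) z, ∀ y ∈ Icc (I i) z,
        |ψ x - ψ y| ≤ ε := by
      intro z hz x hx y hy
      refine hfine x ⟨hsI.trans hx.1, (hx.2.trans hz.2).trans (hIv.trans hvt.le)⟩ y
        ⟨hsI.trans hy.1, (hy.2.trans hz.2).trans (hIv.trans hvt.le)⟩ (le_trans ?_ hlen)
      have h1 : (I i : ℝ) ≤ x := by exact_mod_cast hx.1
      have h2 : (x : ℝ) ≤ I (i + 1) := by exact_mod_cast hx.2.trans hz.2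
      have h3 : (I i : ℝ) ≤ y := by exact_mod_cast hy.1
      have h4 : (y : ℝ) ≤ I (i + 1) := by exact_mod_cast hy.2.trans hz.2
      exact abs_le.2 ⟨by linarith, by linarith⟩
    have hdown' := hdown.mono_left hsI
    have hup' := hup.mono_left hsI
    refine eVariationOn_Icc_le_of_antitoneOn_or_monotoneOn hII ?_ ?_
    -- A path starting a piece in the upper half stays above `(a + b) / 2 - ε > a` throughout, so it
    -- is never pushed up there; the lower half is symmetric.
    · rcases le_total ((a + b) / 2) (φ (I i)) with hm | hm
      · left
        intro x hx y hy hxy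
        refine hdown'.le_of_forall_lt x y hx.1 hxy ((hy.2.trans hIv).trans_lt hvt) ?_
        intro z hz
        have hzI : z ∈ Icc (I i) (I (i + 1)) := ⟨hx.1.trans hz.1.le, hz.2.trans hy.2⟩
        have := hup'.min_sub_le hdec hψ (hosc z hzI) hzI.1 ((hzI.2.trans hIv).trans_lt hvt)
        have h5 : (a + b) / 2 ≤ min (φ (I i)) b := le_min hm (by linarith)
        linarith
      · right
        intro x hx y hy hxy
        have := hup'.le_of_forall_lt x y hx.1 hxy ((hy.2.trans hIv).trans_lt hvt) ?_
        · simpa using this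
        intro z hz
        have hzI : z ∈ Icc (I i) (I (i + 1)) := ⟨hx.1.trans hz.1.le, hz.2.trans hy.2⟩
        have := hdown'.le_max_add hdec hψ (hosc z hzI) hzI.1 ((hzI.2.trans hIv).trans_lt hvt)
        have h5 : max (φ (I i)) a ≤ (a + b) / 2 := max_le hm (by linarith)
        simp only [Pi.neg_apply]
        linarith
    -- As `η = φ - ψ`, an increment costs two deviations `D + O` of `φ` and one oscillation `O` of
    -- `ψ`.
    · have hIt : I (i + 1) < t := hIv.trans_lt hvt
      have h1 := abs_le.1 (hglob _ hsI (hII.trans_lt hIt))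
      have h2 := abs_le.1 (hglob _ (hsI.trans hII) hIt)
      have h3 := abs_le.1 (hO _ ⟨hsI, (hII.trans hIt.le)⟩ _ ⟨hsI.trans hII, hIt.le⟩)
      have h4 := hdec (I i)
      have h5 := hdec (I (i + 1))
      exact abs_le.2 ⟨by linarith, by linarith⟩
  calc eVariationOn η (Icc s v)
      = ∑ i ∈ Finset.range J, eVariationOn η (Icc (I i) (I (i + 1))) := by
        rw [eVariationOn.sum' η hImono, hI0, hIJ]
    _ ≤ ∑ _i ∈ Finset.range J, ENNReal.ofReal (2 * D + 3 * O) := Finset.sum_le_sum hpiece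
    _ = J * ENNReal.ofReal (2 * D + 3 * O) := by simp

lemma eVariationOn_Ico_le {η : ℝ≥0 → ℝ} {s t : ℝ≥0} {C : ℝ≥0∞}
    (h : ∀ v, s ≤ v → v < t → eVariationOn η (Icc s v) ≤ C) : eVariationOn η (Ico s t) ≤ C := by
  rw [eVariationOn.eq_biSup_inter_Icc]
  refine iSup₂_le fun p hp => ?_
  refine (eVariationOn.mono η ?_).trans (h p.2 hp.2.1.1 hp.2.1.2)
  exact fun z hz => ⟨hz.1.1, hz.2.2⟩

/-- The variation on a closed interval in terms of that on the half-open interval and the jump at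
the right end point. -/
lemma eVariationOn_Icc_eq_Ico_add_edist {η : ℝ≥0 → ℝ} {s t : ℝ≥0} {y : ℝ} (hst : s < t)
    (hy : Tendsto η (𝓝[<] t) (𝓝 y)) :
    eVariationOn η (Icc s t) = eVariationOn η (Ico s t) + edist (η t) y := by
  have h1 : Ici s ∩ Iio t = Ico s t := rfl
  have h2 : Ici s ∩ Iic t = Icc s t := rfl
  have h3 : 𝓝[Ico s t] t = 𝓝[<] t := nhdsWithin_Ico_eq_nhdsLT hst
  rw [← h1, ← h2]
  refine eVariationOn.eVariationOn_on_inter_Iic_eq_Iio_add_edist ?_ hst.le ?_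
  · rw [h1, h3]
    exact nhdsLT_neBot_of_exists_lt ⟨s, hst⟩
  · rw [h1, h3]; exact hy

/-! ### Hölder control of a path by its dyadic energy. -/

/-- Weighted sum of eighth powers of the dyadic increments of `X` on `[0, 1]`; it controls the
Hölder seminorm of order `1/4`. -/
noncomputable def dyadicEnergy (X : ℝ≥0 → ℝ) : ℝ≥0∞ :=
  ∑' n : ℕ, ∑ i ∈ Finset.range (2 ^ n),
    4 ^ n * ‖X (((i + 1 : ℕ) : ℝ≥0) / 2 ^ n) - X ((i : ℝ≥0) / 2 ^ n)‖ₑ ^ 8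

/-- A single term of the sum is at most the total, and the eighth root of the weight `4 ^ n` is `2 ^
(n / 4)`, that is `ρ ^ (-n)`. -/
lemma abs_increment_le_of_dyadicEnergy_le {X : ℝ≥0 → ℝ} {μ ρ : ℝ} (hμ : 0 ≤ μ) (hρ : 0 ≤ ρ)
    (hρ4 : ρ ^ 4 = 1 / 2) (h : dyadicEnergy X ≤ ENNReal.ofReal (μ ^ 8)) (n i : ℕ) (hi : i < 2 ^ n) :
    |X (((i + 1 : ℕ) : ℝ≥0) / 2 ^ n) - X ((i : ℝ≥0) / 2 ^ n)| ≤ μ * ρ ^ n := by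
  set d := X (((i + 1 : ℕ) : ℝ≥0) / 2 ^ n) - X ((i : ℝ≥0) / 2 ^ n) with hd
  have h1 : 4 ^ n * ‖d‖ₑ ^ 8 ≤ ENNReal.ofReal (μ ^ 8) := by
    refine le_trans ?_ h
    refine le_trans ?_ (ENNReal.le_tsum n)
    exact Finset.single_le_sum (f := fun i : ℕ => (4 : ℝ≥0∞) ^ n *
      ‖X (((i + 1 : ℕ) : ℝ≥0) / 2 ^ n) - X ((i : ℝ≥0) / 2 ^ n)‖ₑ ^ 8)
      (fun _ _ => zero_le) (Finset.mem_range.2 hi)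
  have h2 : (4 : ℝ) ^ n * |d| ^ 8 ≤ μ ^ 8 := by
    have e : (4 : ℝ≥0∞) ^ n * ‖d‖ₑ ^ 8 = ENNReal.ofReal (4 ^ n * |d| ^ 8) := by
      rw [ENNReal.ofReal_mul (by positivity), ENNReal.ofReal_pow (by positivity),
        ENNReal.ofReal_pow (by positivity), Real.enorm_eq_ofReal_abs]
      norm_num
    rw [e] at h1
    exact (ENNReal.ofReal_le_ofReal_iff (by positivity)).1 h1
  have h3 : ρ ^ 8 = 1 / 4 := by
    rw [show ρ ^ 8 = (ρ ^ 4) ^ 2 by ring, hρ4]; norm_num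
  refine le_of_pow_le_pow_left₀ (n := 8) (by norm_num) (by positivity) ?_
  have h4 : (μ * ρ ^ n) ^ 8 = μ ^ 8 * (1 / 4) ^ n := by
    rw [mul_pow, ← pow_mul, mul_comm n 8, pow_mul, h3]
  rw [h4, one_div, inv_pow, ← div_eq_mul_inv, le_div_iff₀ (by positivity)]
  linarith

/-- Dyadic chaining. -/
lemma abs_sub_le_of_dyadic_increments {X : ℝ≥0 → ℝ} (hX : Continuous X) {M ρ : ℝ} (hM : 0 ≤ M)
    (hρ0 : 0 ≤ ρ) (hρ1 : ρ < 1)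
    (h : ∀ n i : ℕ, i < 2 ^ n →
      |X (((i + 1 : ℕ) : ℝ≥0) / 2 ^ n) - X ((i : ℝ≥0) / 2 ^ n)| ≤ M * ρ ^ n)
    (n : ℕ) {u v : ℝ≥0} (hu : u ≤ 1) (hv : v ≤ 1) (huv : |(u : ℝ) - v| ≤ 1 / 2 ^ n) :
    |X u - X v| ≤ M * (1 + 2 / (1 - ρ)) * ρ ^ n := by
  have hρ' : 0 < 1 - ρ := by linarith
  set q : ℕ → ℝ≥0 → ℕ := fun n u => ⌊(2 : ℝ≥0) ^ n * u⌋₊ with hq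
  -- Passing from level `n` to `n + 1`, the dyadic truncation of `w` stays put or moves by one
  -- dyadic step, so the errors form a geometric series.
  have approx : ∀ w : ℝ≥0, w ≤ 1 → |X ((q n w : ℝ≥0) / 2 ^ n) - X w| ≤ M * ρ ^ n / (1 - ρ) := by
    intro w hw
    rw [← Real.dist_eq]
    refine dist_le_of_le_geometric_of_tendsto (f := fun n => X ((q n w : ℝ≥0) / 2 ^ n)) ρ M hρ1
      (fun n => ?_) ?_ n
    · have h1 : (q n w : ℝ≥0) ≤ 2 ^ n * w := Nat.floor_le (zero_le)
      have h2 : (2 : ℝ≥0) ^ n * w < q n w + 1 := Nat.lt_floor_add_one _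
      have h3 : 2 * q n w ≤ q (n + 1) w := by
        refine Nat.le_floor ?_
        push_cast
        rw [pow_succ, mul_comm _ (2 : ℝ≥0), mul_assoc]
        gcongr
      have h4 : q (n + 1) w < 2 * q n w + 2 := by
        refine (Nat.floor_lt (zero_le)).2 ?_
        push_cast
        rw [pow_succ, mul_comm _ (2 : ℝ≥0), mul_assoc]
        calc 2 * (2 ^ n * w) < 2 * (q n w + 1 : ℝ≥0) := by gcongr
          _ = _ := by ring
      have h5 : ((q n w : ℕ) : ℝ≥0) / 2 ^ n = ((2 * q n w : ℕ) : ℝ≥0) / 2 ^ (n + 1) := by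
        push_cast
        rw [pow_succ, mul_comm _ (2 : ℝ≥0), mul_div_mul_left _ _ two_ne_zero]
      rw [h5]
      have hstep : M * ρ ^ (n + 1) ≤ M * ρ ^ n := by
        apply mul_le_mul_of_nonneg_left _ hM
        exact pow_le_pow_of_le_one hρ0 hρ1.le (Nat.le_succ n)
      rcases (by omega : q (n + 1) w = 2 * q n w ∨ q (n + 1) w = 2 * q n w + 1) with h6 | h6
      · rw [h6, dist_self]; positivity
      · rw [h6, Real.dist_eq, abs_sub_comm]
        refine (h (n + 1) (2 * q n w) ?_).trans hstep
        have h7 : ((q (n + 1) w : ℕ) : ℝ≥0) ≤ 2 ^ (n + 1) * w := Nat.floor_le (zero_le)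
        have h8 : ((q (n + 1) w : ℕ) : ℝ≥0) ≤ ((2 ^ (n + 1) : ℕ) : ℝ≥0) := by
          push_cast
          exact h7.trans (mul_le_of_le_one_right (zero_le) hw)
        have h9 : q (n + 1) w ≤ 2 ^ (n + 1) := by exact_mod_cast h8
        omega
    · refine (hX.tendsto w).comp ?_
      have h1 : Tendsto (fun x : ℝ => (⌊(w : ℝ) * x⌋₊ : ℝ) / x) atTop (𝓝 w) :=
        tendsto_nat_floor_mul_div_atTop w.coe_nonneg
      have h2 : Tendsto (fun n : ℕ => (2 : ℝ) ^ n) atTop atTop :=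
        tendsto_pow_atTop_atTop_of_one_lt (by norm_num)
      refine NNReal.tendsto_coe.1 ((h1.comp h2).congr fun n => ?_)
      have h3 : ⌊(w : ℝ) * 2 ^ n⌋₊ = q n w := by
        have h4 : (q n w : ℝ≥0) ≤ 2 ^ n * w := Nat.floor_le zero_le
        have h5 : 2 ^ n * w < (q n w : ℝ≥0) + 1 := Nat.lt_floor_add_one _
        rw [mul_comm] at h4 h5
        exact (Nat.floor_eq_iff (by positivity)).2 ⟨by exact_mod_cast h4, by exact_mod_cast h5⟩
      simp only [Function.comp_apply, h3, NNReal.coe_div, NNReal.coe_natCast, NNReal.coe_pow,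
        NNReal.coe_ofNat]
  -- Points within `2 ^ (-n)` have truncations that are equal or adjacent.
  have close : |X ((q n u : ℝ≥0) / 2 ^ n) - X ((q n v : ℝ≥0) / 2 ^ n)| ≤ M * ρ ^ n := by
    wlog hle : q n u ≤ q n v generalizing u v
    · rw [abs_sub_comm]
      exact this hv hu (by rwa [abs_sub_comm]) (le_of_not_ge hle)
    have hn : (0 : ℝ) < 2 ^ n := by positivity
    have h1 : q n v ≤ q n u + 1 := by
      have h2 : ((2 : ℝ≥0) ^ n * u : ℝ≥0) < q n u + 1 := Nat.lt_floor_add_one _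
      have h2' : (2 : ℝ) ^ n * u < q n u + 1 := by exact_mod_cast h2
      have h3 : (q n v : ℝ≥0) ≤ 2 ^ n * v := Nat.floor_le (zero_le)
      have h3' : (q n v : ℝ) ≤ 2 ^ n * v := by exact_mod_cast h3
      have h4 : (v : ℝ) - u ≤ 1 / 2 ^ n := by
        have := (abs_le.1 huv).1; linarith
      rw [le_div_iff₀ hn] at h4
      have : (q n v : ℝ) < q n u + 2 := by nlinarith
      have : q n v < q n u + 2 := by exact_mod_cast this
      omega
    rcases (by omega : q n v = q n u ∨ q n v = q n u + 1) with h2 | h2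
    · rw [h2, sub_self, abs_zero]; positivity
    · rw [h2, abs_sub_comm]
      refine h n _ ?_
      have h7 : ((q n v : ℕ) : ℝ≥0) ≤ 2 ^ n * v := Nat.floor_le (zero_le)
      have h8 : ((q n v : ℕ) : ℝ≥0) ≤ ((2 ^ n : ℕ) : ℝ≥0) := by
        push_cast
        exact h7.trans (mul_le_of_le_one_right (zero_le) hv)
      have h9 : q n v ≤ 2 ^ n := by exact_mod_cast h8
      omega
  have h1 := abs_le.1 (approx u hu)
  have h2 := abs_le.1 (approx v hv)
  have h3 := abs_le.1 close
  have h4 : M * (1 + 2 / (1 - ρ)) * ρ ^ n = M * ρ ^ n + 2 * (M * ρ ^ n / (1 - ρ)) := by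
    field_simp
  rw [h4]
  exact abs_le.2 ⟨by linarith, by linarith⟩

/-- The number `J` of pieces on which a path oscillates by less than `w`, and the product of `J`
with the total oscillation, are controlled by the dyadic energy. -/
lemma exists_oscillation_bound {w : ℝ} (hw : 0 < w) :
    ∃ A : ℝ, 0 ≤ A ∧ ∀ X : ℝ≥0 → ℝ, Continuous X → ∀ κ : ℝ, 0 ≤ κ →
      dyadicEnergy X ≤ ENNReal.ofReal κ →
      ∃ (J : ℕ) (O ε : ℝ), 0 < J ∧ 0 ≤ O ∧ 0 ≤ ε ∧ ε < w ∧ J ≤ A * (1 + κ) ∧ J * O ≤ A * (1 + κ) ∧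
        (∀ u v : ℝ≥0, u ≤ 1 → v ≤ 1 → |X u - X v| ≤ O) ∧
        (∀ u v : ℝ≥0, u ≤ 1 → v ≤ 1 → |(u : ℝ) - v| ≤ 1 / J → |X u - X v| ≤ ε) := by
  set ρ : ℝ := (1 / 2 : ℝ) ^ (1 / 4 : ℝ) with hρ
  have hρ0 : 0 < ρ := by positivity
  have hρ1 : ρ < 1 := Real.rpow_lt_one (by norm_num) (by norm_num) (by norm_num)
  have hρ4 : ρ ^ 4 = 1 / 2 := by
    rw [hρ, ← Real.rpow_natCast, ← Real.rpow_mul (by norm_num)]; norm_num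
  set C : ℝ := 1 + 2 / (1 - ρ) with hC
  have hC0 : 0 < C := by
    have : 0 < 1 - ρ := by linarith
    positivity
  set E : ℝ := 1 + 2 * (C / w) ^ 4 with hE
  have hE0 : 1 ≤ E := by rw [hE]; have : 0 ≤ 2 * (C / w) ^ 4 := by positivity
                         linarith
  refine ⟨2 * E * (1 + C), by positivity, fun X hX κ hκ hen => ?_⟩
  set μ : ℝ := κ ^ (1 / 8 : ℝ) with hμdef
  have hμ : 0 ≤ μ := by positivity
  have hμ8 : μ ^ 8 = κ := by
    rw [hμdef, ← Real.rpow_natCast, ← Real.rpow_mul hκ]; norm_num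
  rw [← hμ8] at hen ⊢
  have hchain := fun n u v hu hv huv => abs_sub_le_of_dyadic_increments hX hμ hρ0.le hρ1
    (abs_increment_le_of_dyadicEnergy_le hμ hρ0.le hρ4 hen) n (u := u) (v := v) hu hv huv
  rw [← hC] at hchain
  have hex : ∃ n : ℕ, μ * C * ρ ^ n < w := by
    have : Tendsto (fun n : ℕ => μ * C * ρ ^ n) atTop (𝓝 (μ * C * 0)) :=
      (tendsto_pow_atTop_nhds_zero_of_lt_one hρ0.le hρ1).const_mul _
    rw [mul_zero] at this
    exact (this.eventually_lt_const hw).exists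
  classical
  -- Failure at level `n - 1` gives `2 ^ n ≤ 2 (C μ / w) ^ 4`. Thus `J = 2 ^ n` grows like `μ ^ 4`
  -- and `J * O` like `μ ^ 5`, both dominated by `1 + μ ^ 8 = 1 + κ`. The summand `1` in `E` covers
  -- `n = 0`.
  set n := Nat.find hex with hn
  have hnw : μ * C * ρ ^ n < w := Nat.find_spec hex
  have hJ : ((2 ^ n : ℕ) : ℝ) ≤ E * (1 + μ ^ 4) := by
    push_cast
    rcases Nat.eq_zero_or_pos n with h0 | h0
    · rw [h0, pow_zero]
      have : 0 ≤ μ ^ 4 := by positivity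
      nlinarith
    · obtain ⟨m, hm⟩ := Nat.exists_eq_succ_of_ne_zero h0.ne'
      have h1 : w ≤ μ * C * ρ ^ m := not_lt.1 (Nat.find_min hex (by omega))
      have h2 : w ^ 4 ≤ (μ * C * ρ ^ m) ^ 4 := by gcongr
      have h3 : (μ * C * ρ ^ m) ^ 4 = (μ * C) ^ 4 / 2 ^ m := by
        rw [mul_pow, ← pow_mul, mul_comm m 4, pow_mul, hρ4, one_div, inv_pow]; rfl
      rw [h3, le_div_iff₀ (by positivity)] at h2
      have h4 : (2 : ℝ) ^ n ≤ 2 * (C / w) ^ 4 * μ ^ 4 := by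
        rw [hm, Nat.succ_eq_add_one, pow_succ, div_pow]
        have : (2 : ℝ) ^ m ≤ (μ * C) ^ 4 / w ^ 4 := by
          rw [le_div_iff₀ (by positivity)]; linarith
        calc (2 : ℝ) ^ m * 2 ≤ (μ * C) ^ 4 / w ^ 4 * 2 := by gcongr
          _ = _ := by ring
      have h5 : 0 ≤ μ ^ 4 := by positivity
      have h6 : 0 ≤ (C / w) ^ 4 := by positivity
      rw [hE]
      nlinarith
  have p1 : μ ^ 4 ≤ 1 + μ ^ 8 := by nlinarith [sq_nonneg (μ ^ 4 - 1)]
  have p2 : μ ≤ 1 + μ ^ 8 := by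
    rcases le_total μ 1 with h | h
    · have : 0 ≤ μ ^ 8 := by positivity
      linarith
    · have := pow_le_pow_right₀ h (show 1 ≤ 8 by norm_num)
      rw [pow_one] at this
      linarith
  have p3 : μ * μ ^ 4 ≤ 1 + μ ^ 8 := by
    rcases le_total μ 1 with h | h
    · have : 0 ≤ μ ^ 8 := by positivity
      have := pow_le_one₀ hμ h (n := 5)
      nlinarith
    · have := pow_le_pow_right₀ h (show 5 ≤ 8 by norm_num)
      nlinarith
  have p0 : 0 ≤ μ ^ 8 := by positivity
  refine ⟨2 ^ n, μ * C, μ * C * ρ ^ n, by positivity, by positivity, by positivity, hnw,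
    ?_, ?_, ?_, ?_⟩
  · calc ((2 ^ n : ℕ) : ℝ) ≤ E * (1 + μ ^ 4) := hJ
      _ ≤ E * (2 * (1 + μ ^ 8)) := by gcongr; linarith
      _ = 2 * E * 1 * (1 + μ ^ 8) := by ring
      _ ≤ 2 * E * (1 + C) * (1 + μ ^ 8) := by gcongr; linarith
  · calc ((2 ^ n : ℕ) : ℝ) * (μ * C) ≤ E * (1 + μ ^ 4) * (μ * C) := by gcongr
      _ = E * C * (μ + μ * μ ^ 4) := by ring
      _ ≤ E * C * (2 * (1 + μ ^ 8)) := by gcongr; linarith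
      _ = 2 * E * C * (1 + μ ^ 8) := by ring
      _ ≤ 2 * E * (1 + C) * (1 + μ ^ 8) := by gcongr; linarith
  · intro u v hu hv
    have hu' : (u : ℝ) ≤ 1 := by exact_mod_cast hu
    have hv' : (v : ℝ) ≤ 1 := by exact_mod_cast hv
    have := hchain 0 u v hu hv (by
      rw [pow_zero, div_one]
      exact abs_le.2 ⟨by linarith [u.coe_nonneg], by linarith [v.coe_nonneg]⟩)
    simpa using this
  · intro u v hu hv huv
    exact hchain n u v hu hv (by simpa using huv)

/-! ### Gaussian eighth moments and the mean energy of Brownian motion. -/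

lemma lintegral_enorm_pow_gaussianReal (v : ℝ≥0) :
    ∫⁻ x, ‖x‖ₑ ^ 8 ∂(gaussianReal 0 v) = v ^ 4 * ∫⁻ x, ‖x‖ₑ ^ 8 ∂(gaussianReal 0 1) := by
  have h := gaussianReal_map_const_mul (μ := 0) (v := 1) (√(v : ℝ))
  have e : (⟨√(v : ℝ) ^ 2, sq_nonneg _⟩ : ℝ≥0) * 1 = v := by
    ext; simp
  have hm : gaussianReal 0 v = (gaussianReal 0 1).map (√(v : ℝ) * ·) := by
    rw [h, mul_zero]; congr 1; exact e.symm
  rw [hm, lintegral_map (by fun_prop) (by fun_prop),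
    ← lintegral_const_mul _ (by fun_prop)]
  refine lintegral_congr fun x => ?_
  rw [enorm_mul, mul_pow, Real.enorm_eq_ofReal_abs (√(v : ℝ)), abs_of_nonneg (Real.sqrt_nonneg _),
    ← ENNReal.ofReal_pow (Real.sqrt_nonneg _),
    show √(v : ℝ) ^ 8 = (v : ℝ) ^ 4 by
      rw [show √(v : ℝ) ^ 8 = (√(v : ℝ) ^ 2) ^ 4 by ring, Real.sq_sqrt v.coe_nonneg],
    ENNReal.ofReal_pow v.coe_nonneg, ENNReal.ofReal_coe_nnreal]

lemma lintegral_enorm_pow_gaussianReal_lt_top :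
    ∫⁻ x, ‖x‖ₑ ^ 8 ∂(gaussianReal 0 1) < ∞ := by
  have h := (memLp_id_gaussianReal (μ := 0) (v := 1) 8).eLpNorm_lt_top
  have h1 := lintegral_rpow_enorm_lt_top_of_eLpNorm_lt_top (p := ((8 : ℝ≥0) : ℝ≥0∞))
    (by simp) (by simp) h
  have e : (((8 : ℝ≥0) : ℝ≥0∞)).toReal = ((8 : ℕ) : ℝ) := by norm_num
  simpa only [e, ENNReal.rpow_natCast, id] using h1

section Brownian

variable {Ω : Type*} [MeasurableSpace Ω] {P : Measure Ω} {B : ℝ≥0 → Ω → ℝ}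

lemma aemeasurable_dyadicEnergy (hB : IsPreBrownianReal B P) :
    AEMeasurable (fun ω => dyadicEnergy fun t => B t ω) P := by
  unfold dyadicEnergy
  refine AEMeasurable.tsum fun n => ?_
  refine Finset.aemeasurable_fun_sum _ fun i _ => ?_
  exact (((hB.aemeasurable _).sub (hB.aemeasurable _)).enorm.pow_const 8).const_mul _

/-- The expected dyadic energy of a Brownian motion is twice the eighth moment of the standard
normal law. -/
lemma lintegral_dyadicEnergy (hB : IsPreBrownianReal B P) :
    ∫⁻ ω, dyadicEnergy (fun t => B t ω) ∂P = 2 * ∫⁻ x, ‖x‖ₑ ^ 8 ∂(gaussianReal 0 1) := by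
  set κ := ∫⁻ x, ‖x‖ₑ ^ 8 ∂(gaussianReal 0 1) with hκ
  have hmeas : ∀ s t, AEMeasurable (fun ω => ‖B s ω - B t ω‖ₑ ^ 8) P := fun s t =>
    ((hB.aemeasurable s).sub (hB.aemeasurable t)).enorm.pow_const 8
  have hincr : ∀ n i : ℕ, ∫⁻ ω, 4 ^ n *
      ‖B (((i + 1 : ℕ) : ℝ≥0) / 2 ^ n) ω - B ((i : ℝ≥0) / 2 ^ n) ω‖ₑ ^ 8 ∂P =
      4 ^ n * ((2⁻¹ ^ n) ^ 4 * κ) := by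
    intro n i
    rw [lintegral_const_mul'' _ (hmeas _ _)]
    congr 1
    have h := hB.hasLaw_sub (((i + 1 : ℕ) : ℝ≥0) / 2 ^ n) ((i : ℝ≥0) / 2 ^ n)
    have h1 := h.lintegral_comp (f := fun x : ℝ => ‖x‖ₑ ^ 8) (by fun_prop)
    simp only [Pi.sub_apply] at h1
    rw [h1, lintegral_enorm_pow_gaussianReal]
    congr 2
    have h2 : nndist (((((i + 1 : ℕ) : ℝ≥0) / 2 ^ n : ℝ≥0)) : ℝ)
        ((((i : ℝ≥0) / 2 ^ n : ℝ≥0)) : ℝ) = 2⁻¹ ^ n := by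
      ext
      rw [coe_nndist, Real.dist_eq]
      push_cast
      rw [← sub_div, add_sub_cancel_left, abs_of_nonneg (by positivity), one_div, inv_pow]
    erw [h2]
    rw [ENNReal.coe_pow, ENNReal.coe_inv two_ne_zero, ENNReal.coe_ofNat]
  unfold dyadicEnergy
  rw [lintegral_tsum fun n => Finset.aemeasurable_fun_sum _ fun i _ =>
    (hmeas _ _).const_mul _]
  -- Level `n` has `2 ^ n` increments of variance `2 ^ (-n)`, hence contributes `2 ^ n * 4 ^ n * 2 ^
  -- (-4n) * κ = 2 ^ (-n) * κ`.
  calc ∑' n : ℕ, ∫⁻ ω, ∑ i ∈ Finset.range (2 ^ n), 4 ^ n *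
        ‖B (((i + 1 : ℕ) : ℝ≥0) / 2 ^ n) ω - B ((i : ℝ≥0) / 2 ^ n) ω‖ₑ ^ 8 ∂P
      = ∑' n : ℕ, 2⁻¹ ^ n * κ := by
        congr 1; ext n
        rw [lintegral_finsetSum' _ fun i _ => (hmeas _ _).const_mul _,
          Finset.sum_congr rfl fun i _ => hincr n i, Finset.sum_const, Finset.card_range,
          nsmul_eq_mul, ← mul_assoc, ← mul_assoc]
        congr 1
        have e : (2 : ℝ≥0∞) ^ n * 2⁻¹ ^ n = 1 := by
          rw [← mul_pow, ENNReal.mul_inv_cancel two_ne_zero ENNReal.ofNat_ne_top, one_pow]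
        push_cast
        rw [show (4 : ℝ≥0∞) = 2 * 2 by norm_num, mul_pow]
        calc (2 : ℝ≥0∞) ^ n * (2 ^ n * 2 ^ n) * (2⁻¹ ^ n) ^ 4
            = (2 ^ n * 2⁻¹ ^ n) ^ 3 * 2⁻¹ ^ n := by ring
          _ = 2⁻¹ ^ n := by rw [e, one_pow, one_mul]
    _ = 2 * κ := by
        rw [ENNReal.tsum_mul_right, ENNReal.tsum_geometric, ENNReal.one_sub_inv_two, inv_inv]

end Brownian

/-! ### From boundaries and the Skorokhod conditions to one-box estimates. -/

section Deviation

lemma ofReal_sub_le_devFrom_of_le {x m : ℝ} {y : EReal} (h : (x : EReal) ≤ y) :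
    ENNReal.ofReal (x - m) ≤ devFrom m y := by
  unfold devFrom
  induction y with
  | bot => simp at h
  | top => simp
  | coe y =>
    rw [← EReal.coe_sub, EReal.abs_def]
    have : x ≤ y := by exact_mod_cast h
    exact ENNReal.ofReal_le_ofReal ((sub_le_sub_right this m).trans (le_abs_self _))

lemma ofReal_sub_le_devFrom_of_ge {x m : ℝ} {y : EReal} (h : y ≤ (x : EReal)) :
    ENNReal.ofReal (m - x) ≤ devFrom m y := by
  unfold devFrom
  induction y with
  | bot => simp
  | top => simp at h
  | coe y =>
    rw [← EReal.coe_sub, EReal.abs_def]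
    have : y ≤ x := by exact_mod_cast h
    refine ENNReal.ofReal_le_ofReal (le_trans ?_ (neg_le_abs _))
    linarith

lemma ofReal_abs_sub_le_devFrom_add {x m : ℝ} {y z : EReal} (hy : y ≤ (x : EReal))
    (hz : (x : EReal) ≤ z) : ENNReal.ofReal |x - m| ≤ devFrom m z + devFrom m y := by
  rcases le_total m x with h | h
  · rw [abs_of_nonneg (by linarith)]
    exact (ofReal_sub_le_devFrom_of_le hz).trans le_self_add
  · rw [abs_of_nonpos (by linarith), neg_sub]
    exact (ofReal_sub_le_devFrom_of_ge hy).trans le_add_self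

end Deviation

section Box

variable {ℓ r : ℝ≥0 → EReal} {ψ φ η : ℝ≥0 → ℝ} {a b : ℝ} {s t : ℝ≥0}

/-- A value of `ℓ` above `a` would exclude points of the box just above `a`; right continuity then
reaches the left end point `s`. -/
lemma lower_le_of_box (hℓ : IsCadlagLower ℓ) (hst : s < t) (hab : a < b)
    (hbox : Ioo s t ×ˢ Ioo a b ⊆ spaceTimeDomain ℓ r) : ∀ u ∈ Ico s t, ℓ u ≤ a := by
  have hin : ∀ u ∈ Ioo s t, ℓ u ≤ a := by
    intro u hu
    by_contra hcon
    have h1 : (a : EReal) < min (ℓ u) b := lt_min (not_le.1 hcon) (by exact_mod_cast hab)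
    obtain ⟨x, hax, hx⟩ := EReal.lt_iff_exists_real_btwn.1 h1
    have h2 := (hbox (show (u, x) ∈ Ioo s t ×ˢ Ioo a b from
      ⟨hu, by exact_mod_cast hax, by exact_mod_cast hx.trans_le (min_le_right _ _)⟩)).1
    exact absurd h2 (not_lt.2 (hx.le.trans (min_le_left _ _)))
  intro u hu
  rcases hu.1.eq_or_lt with h | h
  · subst h
    have h1 : Tendsto ℓ (𝓝[>] s) (𝓝 (ℓ s)) :=
      (hℓ.right_cont s).mono Ioi_subset_Ici_self
    have : (𝓝[>] s).NeBot := nhdsGT_neBot_of_exists_gt ⟨t, hst⟩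
    exact le_of_tendsto h1 (eventually_of_mem (Ioo_mem_nhdsGT hst) hin)
  · exact hin u ⟨h, hu.2⟩

lemma le_upper_of_box (hr : IsCadlagUpper r) (hst : s < t) (hab : a < b)
    (hbox : Ioo s t ×ˢ Ioo a b ⊆ spaceTimeDomain ℓ r) : ∀ u ∈ Ico s t, (b : EReal) ≤ r u := by
  have hin : ∀ u ∈ Ioo s t, (b : EReal) ≤ r u := by
    intro u hu
    by_contra hcon
    have h1 : max (r u) a < (b : EReal) := max_lt (not_le.1 hcon) (by exact_mod_cast hab)
    obtain ⟨x, hax, hx⟩ := EReal.lt_iff_exists_real_btwn.1 h1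
    have h2 := (hbox (show (u, x) ∈ Ioo s t ×ˢ Ioo a b from
      ⟨hu, by exact_mod_cast (le_max_right _ _).trans_lt hax, by exact_mod_cast hx⟩)).2
    exact absurd h2 (not_lt.2 ((le_max_left _ _).trans hax.le))
  intro u hu
  rcases hu.1.eq_or_lt with h | h
  · subst h
    have h1 : Tendsto r (𝓝[>] s) (𝓝 (r s)) :=
      (hr.right_cont s).mono Ioi_subset_Ici_self
    have : (𝓝[>] s).NeBot := nhdsGT_neBot_of_exists_gt ⟨t, hst⟩
    exact ge_of_tendsto h1 (eventually_of_mem (Ioo_mem_nhdsGT hst) hin)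
  · exact hin u ⟨h, hu.2⟩

lemma neBot_nhdsLT_of_pos {z : ℝ≥0} (hz : 0 < z) : (𝓝[<] z).NeBot :=
  nhdsLT_neBot_of_exists_lt ⟨0, hz⟩

lemma leftValue_eq_of_tendsto {z : ℝ≥0} {y : ℝ} (hz : 0 < z) (hy : Tendsto η (𝓝[<] z) (𝓝 y)) :
    leftValue η z = y := by
  rw [leftValue, if_neg hz.ne']
  have := neBot_nhdsLT_of_pos hz
  exact leftLim_eq_of_tendsto hy

lemma SolvesESP.decreasesAbove (h : SolvesESP ℓ r ψ φ η) (hℓ : ∀ u ∈ Ico s t, ℓ u ≤ a) :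
    DecreasesAbove φ η a s t where
  le_of_forall_lt u v hsu huv hvt hz := by
    have := h.nonincreasing u v huv fun z hzm =>
      (hℓ z ⟨hsu.trans hzm.1.le, hzm.2.trans_lt hvt⟩).trans_lt (by exact_mod_cast hz z hzm)
    linarith
  le_left_lim z hsz hzt := by
    have hz : 0 < z := zero_le.trans_lt hsz
    obtain ⟨y, -, hy⟩ := h.cadlag_constraining.left_lim z hz
    refine ⟨y, hy, fun haz => ?_⟩
    have := h.jump_nonpos z ((hℓ z ⟨hsz.le, hzt⟩).trans_lt (by exact_mod_cast haz))
    rw [leftValue_eq_of_tendsto hz hy] at this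
    linarith

lemma SolvesESP.increasesBelow (h : SolvesESP ℓ r ψ φ η)
    (hr : ∀ u ∈ Ico s t, (b : EReal) ≤ r u) : DecreasesAbove (-φ) (-η) (-b) s t where
  le_of_forall_lt u v hsu huv hvt hz := by
    have := h.nondecreasing u v huv fun z hzm =>
      lt_of_lt_of_le (by exact_mod_cast neg_lt_neg_iff.1 (hz z hzm))
        (hr z ⟨hsu.trans hzm.1.le, hzm.2.trans_lt hvt⟩)
    simp only [Pi.neg_apply]
    linarith
  le_left_lim z hsz hzt := by
    have hz : 0 < z := zero_le.trans_lt hsz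
    obtain ⟨y, -, hy⟩ := h.cadlag_constraining.left_lim z hz
    refine ⟨-y, hy.neg, fun haz => ?_⟩
    have := h.jump_nonneg z
      (lt_of_lt_of_le (by exact_mod_cast neg_lt_neg_iff.1 haz) (hr z ⟨hsz.le, hzt⟩))
    rw [leftValue_eq_of_tendsto hz hy] at this
    simp only [Pi.neg_apply]
    linarith

/-- The jump of the constraining path is at most twice the deviation of the boundaries. -/
lemma SolvesESP.edist_left_lim_le (h : SolvesESP ℓ r ψ φ η) (hℓ : IsCadlagLower ℓ)
    (hr : IsCadlagUpper r) (hψ : Continuous ψ) (ht : 0 < t) {y : ℝ}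
    (hy : Tendsto η (𝓝[<] t) (𝓝 y)) (m : ℝ) :
    edist (η t) y ≤ 2 * boundaryDevLeft ℓ r m t := by
  have hne := neBot_nhdsLT_of_pos ht
  have hφ : Tendsto φ (𝓝[<] t) (𝓝 (ψ t + y)) := by
    rw [show φ = fun z => ψ z + η z from funext h.decomp]
    exact ((hψ.tendsto t).mono_left nhdsWithin_le_nhds).add hy
  have hφ' : Tendsto (fun z => (φ z : EReal)) (𝓝[<] t) (𝓝 ((ψ t + y : ℝ) : EReal)) :=
    (continuous_coe_real_ereal.tendsto _).comp hφ
  obtain ⟨L, -, hL⟩ := hℓ.left_lim t ht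
  obtain ⟨R, -, hR⟩ := hr.left_lim t ht
  have hL1 : L ≤ ((ψ t + y : ℝ) : EReal) :=
    le_of_tendsto_of_tendsto' hL hφ' fun z => (h.mem_interval z).1
  have hR1 : ((ψ t + y : ℝ) : EReal) ≤ R :=
    le_of_tendsto_of_tendsto' hφ' hR fun z => (h.mem_interval z).2
  rw [← leftLim_eq_of_tendsto hL] at hL1
  rw [← leftLim_eq_of_tendsto hR] at hR1
  have h1 : ENNReal.ofReal |φ t - m| ≤ boundaryDevLeft ℓ r m t :=
    (ofReal_abs_sub_le_devFrom_add (h.mem_interval t).1 (h.mem_interval t).2).trans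
      (add_le_add (le_max_left _ _) (le_max_left _ _))
  have h2 : ENNReal.ofReal |ψ t + y - m| ≤ boundaryDevLeft ℓ r m t :=
    (ofReal_abs_sub_le_devFrom_add hL1 hR1).trans
      (add_le_add (le_max_right _ _) (le_max_right _ _))
  have h3 : |η t - y| ≤ |φ t - m| + |ψ t + y - m| := by
    rw [show η t - y = (φ t - m) - (ψ t + y - m) by rw [h.decomp t]; ring]
    exact abs_sub _ _
  rw [edist_dist, Real.dist_eq, two_mul]
  exact (ENNReal.ofReal_le_ofReal h3).trans (ENNReal.ofReal_add_le.trans (add_le_add h1 h2))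

end Box

/-- The variation of the constraining path over one box. -/
lemma exists_eVariationOn_box_le {c₁ : ℝ} (hc₁ : 0 < c₁) :
    ∃ A : ℝ≥0∞, A ≠ ∞ ∧ ∀ (ℓ r : ℝ≥0 → EReal) (ψ φ η : ℝ≥0 → ℝ) (a b : ℝ) (s t : ℝ≥0),
      IsCadlagLower ℓ → IsCadlagUpper r → SolvesESP ℓ r ψ φ η → Continuous ψ → s < t →
      Ioo s t ×ˢ Ioo a b ⊆ spaceTimeDomain ℓ r → 1 / c₁ * √((t : ℝ) - s) < b - a →
      eVariationOn η (Icc s t) ≤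
        A * (1 + dyadicEnergy fun θ => (√((t - s : ℝ≥0) : ℝ))⁻¹ * (ψ (s + (t - s) * θ) - ψ s)) *
          (boundaryDev ℓ r ((a + b) / 2) s + ENNReal.ofReal √((t : ℝ) - s)) +
        2 * boundaryDevLeft ℓ r ((a + b) / 2) t := by
  -- Dividing space by `√(t - s)` makes the half-width of every box exceed `1 / (2 * c₁)`, so one
  -- `A` serves all boxes.
  obtain ⟨A, hA0, hA⟩ := exists_oscillation_bound (w := 1 / (2 * c₁)) (by positivity)
  refine ⟨ENNReal.ofReal (3 * A + 1), ENNReal.ofReal_ne_top, ?_⟩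
  intro ℓ r ψ φ η a b s t hℓ hr h hψ hst hbox hsize
  have hΔ : (0 : ℝ) < (t : ℝ) - s := sub_pos.2 (by exact_mod_cast hst)
  have hcoe : ((t - s : ℝ≥0) : ℝ) = (t : ℝ) - s := NNReal.coe_sub hst.le
  set δ := √((t : ℝ) - s) with hδ
  have hδ0 : 0 < δ := Real.sqrt_pos.2 hΔ
  have hab : a < b := by
    have : 0 < 1 / c₁ * δ := by positivity
    linarith
  rw [hcoe, ← hδ]
  set X : ℝ≥0 → ℝ := fun θ => δ⁻¹ * (ψ (s + (t - s) * θ) - ψ s) with hX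
  have hXc : Continuous X := by fun_prop
  obtain ⟨y, -, hy⟩ := h.cadlag_constraining.left_lim t (zero_le.trans_lt hst)
  rw [eVariationOn_Icc_eq_Ico_add_edist hst hy]
  refine add_le_add ?_ (h.edist_left_lim_le hℓ hr hψ (zero_le.trans_lt hst) hy _)
  -- Infinite energy makes the bound infinite, provided the other factors are nonzero; hence the `+
  -- 1` in `3 * A + 1`.
  rcases eq_or_ne (dyadicEnergy X) ∞ with htop | htop
  · have h1 : ENNReal.ofReal (3 * A + 1) ≠ 0 := (ENNReal.ofReal_pos.2 (by linarith)).ne'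
    have h2 : boundaryDev ℓ r ((a + b) / 2) s + ENNReal.ofReal δ ≠ 0 :=
      ((ENNReal.ofReal_pos.2 hδ0).trans_le le_add_self).ne'
    rw [htop, add_top, ENNReal.mul_top h1, ENNReal.top_mul h2]
    exact le_top
  obtain ⟨J, O, ε, hJ, hO0, hε0, hεw, hJA, hJOA, hO, hfine⟩ :=
    hA X hXc (dyadicEnergy X).toReal ENNReal.toReal_nonneg (ENNReal.ofReal_toReal htop).ge
  set κ := (dyadicEnergy X).toReal with hκ
  set D := |φ s - (a + b) / 2| with hD
  have hrep : ∀ u ∈ Icc s t, ∃ θ : ℝ≥0, θ ≤ 1 ∧ ψ u = ψ s + δ * X θ ∧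
      (u : ℝ) = s + ((t : ℝ) - s) * θ := by
    intro u hu
    have hts : t - s ≠ 0 := (tsub_pos_of_lt hst).ne'
    have hu' : s + (t - s) * ((u - s) / (t - s)) = u := by
      rw [mul_div_cancel₀ _ hts, add_tsub_cancel_of_le hu.1]
    refine ⟨(u - s) / (t - s), div_le_one_of_le₀ (tsub_le_tsub_right hu.2 s) zero_le, ?_, ?_⟩
    · simp only [hX, hu']
      field_simp
      ring
    · rw [← hcoe]; exact_mod_cast hu'.symm
  refine eVariationOn_Ico_le fun v hsv hvt => ?_
  have hbd := eVariationOn_Icc_le_of_box (J := J) (O := δ * O) (ε := δ * ε) (D := D)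
    (h.decreasesAbove (lower_le_of_box hℓ hst hab hbox))
    (h.increasesBelow (le_upper_of_box hr hst hab hbox)) h.decomp hψ hJ ?_ (by positivity) ?_ ?_
    le_rfl hsv hvt
  · refine hbd.trans ?_
    have e1 : (J : ℝ≥0∞) * ENNReal.ofReal (2 * D + 3 * (δ * O)) =
        ENNReal.ofReal (J * (2 * D + 3 * (δ * O))) := by
      rw [ENNReal.ofReal_mul (by positivity), ENNReal.ofReal_natCast]
    have hκ0 : 0 ≤ κ := ENNReal.toReal_nonneg
    have hD0 : 0 ≤ D := abs_nonneg _
    have e2 : (J : ℝ) * (2 * D + 3 * (δ * O)) ≤ (3 * A + 1) * (1 + κ) * (D + δ) := by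
      have h1 : (J : ℝ) * D ≤ A * (1 + κ) * D := by gcongr
      have h2 : δ * (J * O) ≤ δ * (A * (1 + κ)) := by gcongr
      have h3 : 0 ≤ A * (1 + κ) * D := by positivity
      have h4 : 0 ≤ (1 + κ) * (D + δ) := by positivity
      nlinarith
    rw [e1]
    refine (ENNReal.ofReal_le_ofReal e2).trans ?_
    rw [ENNReal.ofReal_mul (by positivity), ENNReal.ofReal_mul (by positivity),
      ENNReal.ofReal_add (by norm_num) hκ0, ENNReal.ofReal_add hD0 hδ0.le, ENNReal.ofReal_one,
      ENNReal.ofReal_toReal htop]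
    gcongr
    exact ofReal_abs_sub_le_devFrom_add (h.mem_interval s).1 (h.mem_interval s).2
  · refine lt_trans ?_ hsize
    calc 2 * (δ * ε) < 2 * (δ * (1 / (2 * c₁))) := by gcongr
      _ = 1 / c₁ * δ := by field_simp
  · intro u hu v hv
    obtain ⟨θ, hθ, h1, -⟩ := hrep u hu
    obtain ⟨θ', hθ', h2, -⟩ := hrep v hv
    rw [h1, h2, add_sub_add_left_eq_sub, ← mul_sub, abs_mul, abs_of_pos hδ0]
    exact mul_le_mul_of_nonneg_left (hO _ _ hθ hθ') hδ0.le
  · intro u hu v hv huv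
    obtain ⟨θ, hθ, h1, h1'⟩ := hrep u hu
    obtain ⟨θ', hθ', h2, h2'⟩ := hrep v hv
    rw [h1, h2, add_sub_add_left_eq_sub, ← mul_sub, abs_mul, abs_of_pos hδ0]
    refine mul_le_mul_of_nonneg_left (hfine _ _ hθ hθ' ?_) hδ0.le
    rw [h1', h2', add_sub_add_left_eq_sub, ← mul_sub, abs_mul, abs_of_pos hΔ,
      div_eq_mul_one_div] at huv
    exact le_of_mul_le_mul_left huv hΔ

/-! ### Gluing the boxes, and the jump at `τ`. -/

section Partition

variable {s : ℤ → ℝ≥0} {τ : ℝ≥0}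

lemma lt_of_strictMono_of_tendsto_atTop (hs : StrictMono s) (hs_top : Tendsto s atTop (𝓝 τ))
    (k : ℤ) : s k < τ :=
  (hs (lt_add_one k)).trans_le (hs.monotone.ge_of_tendsto hs_top _)

/-- The variation over `[0, τ]` is at most the sum of the variations over the cells of a two-sided
partition of `(0, τ)`, and the jump at `τ`. -/
lemma eVariationOn_Icc_le_tsum_add_edist {η : ℝ≥0 → ℝ} {y : ℝ} (hs : StrictMono s)
    (hs_bot : Tendsto s atBot (𝓝 0)) (hs_top : Tendsto s atTop (𝓝 τ)) (hτ : 0 < τ)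
    (h0 : ContinuousWithinAt η (Ici 0) 0) (hy : Tendsto η (𝓝[<] τ) (𝓝 y)) :
    eVariationOn η (Icc 0 τ) ≤
      ∑' k, eVariationOn η (Icc (s k) (s (k + 1))) + edist (η τ) y := by
  rw [eVariationOn_Icc_eq_Ico_add_edist hτ hy]
  gcongr
  -- The cells never reach `0`; right continuity there lets that point be dropped. Every compact
  -- subinterval of `(0, τ)` then meets only finitely many cells.
  have h1 : eVariationOn η (Iio τ ∩ Ioi 0) = eVariationOn η (Iio τ ∩ Ici 0) := by
    refine eVariationOn.eVariationOn_inter_Ioi_eq_inter_Ici_of_continuousWithinAt ?_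
      (h0.mono inter_subset_right)
    rw [inter_comm, Ioi_inter_Iio, nhdsWithin_Ioo_eq_nhdsGT hτ]
    exact nhdsGT_neBot_of_exists_gt ⟨τ, hτ⟩
  rw [inter_comm (Iio τ), inter_comm (Iio τ), Ioi_inter_Iio, Ici_inter_Iio] at h1
  rw [← h1, eVariationOn.eq_biSup_inter_Icc]
  refine iSup₂_le fun p hp => ?_
  have hA : ∀ᶠ n : ℕ in atTop, s (-(n : ℤ)) ≤ p.1 :=
    (hs_bot.comp (tendsto_neg_atTop_atBot.comp tendsto_natCast_atTop_atTop)).eventually_le_const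
      hp.1.1
  have hB : ∀ᶠ n : ℕ in atTop, p.2 ≤ s (n : ℤ) :=
    (hs_top.comp tendsto_natCast_atTop_atTop).eventually_const_le hp.2.1.2
  obtain ⟨n, hn1, hn2⟩ := (hA.and hB).exists
  set I : ℕ → ℝ≥0 := fun i => s (-(n : ℤ) + i) with hI
  have hImono : Monotone I := fun i j hij => hs.monotone (by omega)
  calc eVariationOn η (Ioo 0 τ ∩ Icc p.1 p.2) ≤ eVariationOn η (Icc (I 0) (I (2 * n))) := by
        refine eVariationOn.mono η fun z hz => ⟨?_, ?_⟩
        · simpa [hI] using hn1.trans hz.2.1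
        · have e : -(n : ℤ) + ((2 * n : ℕ) : ℤ) = n := by push_cast; ring
          simp only [hI, e]
          exact hz.2.2.trans hn2
    _ = ∑ i ∈ Finset.range (2 * n), eVariationOn η (Icc (I i) (I (i + 1))) :=
        (eVariationOn.sum' η hImono).symm
    _ ≤ ∑' i : ℕ, eVariationOn η (Icc (I i) (I (i + 1))) := ENNReal.sum_le_tsum _
    _ ≤ ∑' k : ℤ, eVariationOn η (Icc (s k) (s (k + 1))) := by
        have hinj : Function.Injective fun i : ℕ => -(n : ℤ) + i := fun i j hij => by
          simpa using hij
        refine le_trans (le_of_eq ?_) (ENNReal.tsum_comp_le_tsum_of_injective hinj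
          fun k : ℤ => eVariationOn η (Icc (s k) (s (k + 1))))
        refine tsum_congr fun i => ?_
        simp only [hI]
        rw [Nat.cast_succ, ← add_assoc]

end Partition

/-- At the left limit `τ` of the partition, the jump of the constraining path is bounded by a
constant that depends only on the boundaries. -/
lemma exists_edist_left_lim_le {ℓ r : ℝ≥0 → EReal} {s : ℤ → ℝ≥0} {τ : ℝ≥0} {m : ℤ → ℝ}
    (hℓ : IsCadlagLower ℓ) (hr : IsCadlagUpper r) (hτ : 0 < τ) (hs : StrictMono s)
    (hs_top : Tendsto s atTop (𝓝 τ)) (hd : ∑' k, boundaryDev ℓ r (m k) (s k) < ∞) :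
    ∃ C : ℝ, ∀ (ψ φ η : ℝ≥0 → ℝ) (y : ℝ), SolvesESP ℓ r ψ φ η → Continuous ψ →
      Tendsto η (𝓝[<] τ) (𝓝 y) → edist (η τ) y ≤ ENNReal.ofReal C := by
  obtain ⟨L, hL1, hL⟩ := hℓ.left_lim τ hτ
  obtain ⟨R, hR1, hR⟩ := hr.left_lim τ hτ
  -- Either left limit may be infinite, but `ℓ(τ-) < cu` and `cl < r(τ-)` for some reals. Near `τ`
  -- this traps `m k` in `[cl - S, cu + S]`, and `φ (s k)` is within `S` of `m k`.
  obtain ⟨cu, hcu, -⟩ := EReal.lt_iff_exists_real_btwn.1 hL1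
  obtain ⟨cl, -, hcl⟩ := EReal.lt_iff_exists_real_btwn.1 hR1
  have hsτ : Tendsto s atTop (𝓝[<] τ) := tendsto_nhdsWithin_iff.2
    ⟨hs_top, Eventually.of_forall (lt_of_strictMono_of_tendsto_atTop hs hs_top)⟩
  set S := (∑' k, boundaryDev ℓ r (m k) (s k)).toReal with hS
  have hS0 : 0 ≤ S := ENNReal.toReal_nonneg
  have hle : ∀ k, boundaryDev ℓ r (m k) (s k) ≤ ENNReal.ofReal S := fun k => by
    rw [hS, ENNReal.ofReal_toReal hd.ne]; exact ENNReal.le_tsum k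
  refine ⟨|(ℓ τ).toReal| + |(r τ).toReal| + |cu| + |cl| + 2 * S,
    fun ψ φ η y h hψ hy => ?_⟩
  have hne := neBot_nhdsLT_of_pos hτ
  have hφ : Tendsto (fun k => φ (s k)) atTop (𝓝 (ψ τ + y)) := by
    rw [show φ = fun z => ψ z + η z from funext h.decomp]
    exact (((hψ.tendsto τ).mono_left nhdsWithin_le_nhds).add hy).comp hsτ
  have hbound : ∀ᶠ k in atTop, cl - 2 * S ≤ φ (s k) ∧ φ (s k) ≤ cu + 2 * S := by
    filter_upwards [hsτ.eventually (hL.eventually_lt_const hcu),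
      hsτ.eventually (hR.eventually_const_lt hcl)] with k h1 h2
    have a1 := (ofReal_sub_le_devFrom_of_ge (m := m k) h1.le).trans
      (le_add_self.trans (hle k))
    have a2 := (ofReal_sub_le_devFrom_of_le (m := m k) h2.le).trans
      (le_self_add.trans (hle k))
    have a3 := (ofReal_abs_sub_le_devFrom_add (m := m k) (h.mem_interval (s k)).1
      (h.mem_interval (s k)).2).trans (hle k)
    rw [ENNReal.ofReal_le_ofReal_iff hS0] at a1 a2 a3
    have a4 := abs_le.1 a3
    constructor <;> linarith
  have hlow : cl - 2 * S ≤ ψ τ + y := ge_of_tendsto hφ (hbound.mono fun k hk => hk.1)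
  have hupp : ψ τ + y ≤ cu + 2 * S := le_of_tendsto hφ (hbound.mono fun k hk => hk.2)
  -- Strictly between the boundaries both jump conditions force a zero jump. Otherwise `φ τ` equals
  -- a boundary value, which is then finite, so the default `toReal = 0` at infinity does no harm.
  have hval : η τ = y ∨ |φ τ| ≤ |(ℓ τ).toReal| + |(r τ).toReal| := by
    by_contra! hcon
    have hl : ℓ τ < φ τ := by
      refine lt_of_le_of_ne (h.mem_interval τ).1 fun heq => ?_
      have := abs_nonneg (r τ).toReal
      rw [heq, EReal.toReal_coe] at hcon
      linarith [hcon.2]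
    have hrr : (φ τ : EReal) < r τ := by
      refine lt_of_le_of_ne (h.mem_interval τ).2 fun heq => ?_
      have := abs_nonneg (ℓ τ).toReal
      rw [← heq, EReal.toReal_coe] at hcon
      linarith [hcon.2]
    have h1 := h.jump_nonneg τ hrr
    have h2 := h.jump_nonpos τ hl
    rw [leftValue_eq_of_tendsto hτ hy] at h1 h2
    exact hcon.1 (by linarith)
  rw [edist_dist, Real.dist_eq]
  refine ENNReal.ofReal_le_ofReal ?_
  have n1 := abs_nonneg (ℓ τ).toReal
  have n2 := abs_nonneg (r τ).toReal
  rcases hval with hv | hv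
  · rw [hv, sub_self, abs_zero]; positivity
  · have h1 := abs_le.1 hv
    have h2 := h.decomp τ
    have h3 := le_abs_self cu
    have h4 := neg_abs_le cl
    have h5 := abs_nonneg cu
    have h6 := abs_nonneg cl
    exact abs_le.2 ⟨by linarith, by linarith⟩

theorem mainTheorem4 {Ω : Type*} [MeasurableSpace Ω] (P : Measure Ω) [IsProbabilityMeasure P]
    (B : ℝ≥0 → Ω → ℝ) (hB : IsBrownianReal B P)
    (ℓ r : ℝ≥0 → EReal) (hℓ : IsCadlagLower ℓ) (hr : IsCadlagUpper r) (hℓr : ∀ t, ℓ t ≤ r t)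
    (τ : ℝ≥0) (hτ : IsGLB (contactTimes ℓ r) τ) (hτ_pos : 0 < τ)
    (x : ℝ) (W Y : ℝ≥0 → Ω → ℝ) (hWY : IsRBMWithLocalTime P ℓ r x B W Y)
    (s : ℤ → ℝ≥0) (hs : StrictMono s)
    (hs_bot : Tendsto s atBot (𝓝 0)) (hs_top : Tendsto s atTop (𝓝 τ))
    (c₁ : ℝ) (hc₁ : 0 < c₁) (a b : ℤ → ℝ)
    (hbox : ∀ k, Ioo (s k) (s (k + 1)) ×ˢ Ioo (a k) (b k) ⊆ spaceTimeDomain ℓ r)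
    (hsize : ∀ k, 1 / c₁ * √((s (k + 1) : ℝ) - s k) < b k - a k ∧
      b k - a k < c₁ * √((s (k + 1) : ℝ) - s k))
    (hroots : Summable fun k => √((s (k + 1) : ℝ) - s k))
    (hd : ∑' k, boundaryDev ℓ r ((a k + b k) / 2) (s k) < ∞)
    (hd' : ∑' k, boundaryDevLeft ℓ r ((a k + b k) / 2) (s (k + 1)) < ∞) :
    ∫⁻ ω, eVariationOn (fun t => Y t ω) (Icc 0 τ) ∂P < ∞ := by
  obtain ⟨A, hA, hvar⟩ := exists_eVariationOn_box_le hc₁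
  obtain ⟨C, hC⟩ := exists_edist_left_lim_le hℓ hr hτ_pos hs hs_top hd
  set M := ∫⁻ x, ‖x‖ₑ ^ 8 ∂(gaussianReal 0 1) with hM
  have hMtop : M ≠ ∞ := lintegral_enorm_pow_gaussianReal_lt_top.ne
  set e : ℤ → ℝ≥0∞ := fun k => boundaryDev ℓ r ((a k + b k) / 2) (s k) +
    ENNReal.ofReal √((s (k + 1) : ℝ) - s k) with he
  set e' : ℤ → ℝ≥0∞ := fun k => 2 * boundaryDevLeft ℓ r ((a k + b k) / 2) (s (k + 1)) with he'
  set K : ℤ → Ω → ℝ≥0∞ := fun k ω => dyadicEnergy fun θ =>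
    (√((s (k + 1) - s k : ℝ≥0) : ℝ))⁻¹ * (B (s k + (s (k + 1) - s k) * θ) ω - B (s k) ω) with hK
  have hslt : ∀ k, s k < s (k + 1) := fun k => hs (lt_add_one k)
  -- Markov shift and Brownian scaling: the energies `K k` all have mean `2 * M`, whatever the cell.
  have hscaled : ∀ k, IsPreBrownianReal (fun θ ω => (√((s (k + 1) - s k : ℝ≥0) : ℝ))⁻¹ *
      (B (s k + (s (k + 1) - s k) * θ) ω - B (s k) ω)) P := fun k =>
    (hB.toIsPreBrownianReal.shift (s k)).smul (tsub_pos_of_lt (hslt k)).ne'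
  have hKm : ∀ k, AEMeasurable (K k) P := fun k => aemeasurable_dyadicEnergy (hscaled k)
  have hKint : ∀ k, ∫⁻ ω, K k ω ∂P = 2 * M := fun k => lintegral_dyadicEnergy (hscaled k)
  have hbound : ∀ᵐ ω ∂P, eVariationOn (fun t => Y t ω) (Icc 0 τ) ≤
      ∑' k, (A * (1 + K k ω) * e k + e' k) + ENNReal.ofReal C := by
    filter_upwards [hWY, hB.cont] with ω hω hcont
    have hψ : Continuous fun t => x + B t ω := by fun_prop
    obtain ⟨y, -, hy⟩ := hω.cadlag_constraining.left_lim τ hτ_pos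
    refine (eVariationOn_Icc_le_tsum_add_edist hs hs_bot hs_top hτ_pos
      (hω.cadlag_constraining.right_cont 0) hy).trans
      (add_le_add (ENNReal.tsum_le_tsum fun k => ?_) (hC _ _ _ y hω hψ hy))
    have := hvar ℓ r _ _ _ (a k) (b k) (s k) (s (k + 1)) hℓ hr hω hψ (hslt k) (hbox k) (hsize k).1
    simpa only [add_sub_add_left_eq_sub] using this
  have hm : ∀ k, AEMeasurable (fun ω => A * (1 + K k ω) * e k) P := fun k =>
    (((hKm k).const_add 1).const_mul A).mul_const _
  have hesum : ∑' k, e k < ∞ := by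
    rw [he, ENNReal.tsum_add]
    exact ENNReal.add_lt_top.2 ⟨hd, hroots.tsum_ofReal_lt_top⟩
  have he'sum : ∑' k, e' k < ∞ := by
    rw [he', ENNReal.tsum_mul_left]
    exact ENNReal.mul_lt_top ENNReal.ofNat_lt_top hd'
  calc ∫⁻ ω, eVariationOn (fun t => Y t ω) (Icc 0 τ) ∂P
      ≤ ∫⁻ ω, (∑' k, (A * (1 + K k ω) * e k + e' k) + ENNReal.ofReal C) ∂P :=
        lintegral_mono_ae hbound
    _ = ∑' k, (A * (1 + 2 * M) * e k + e' k) + ENNReal.ofReal C := by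
        rw [lintegral_add_right _ measurable_const, lintegral_const, measure_univ, mul_one,
          lintegral_tsum fun k => (hm k).add_const _]
        congr 1
        refine tsum_congr fun k => ?_
        rw [lintegral_add_right _ measurable_const, lintegral_const, measure_univ, mul_one,
          lintegral_mul_const'' _ (((hKm k).const_add 1).const_mul A),
          lintegral_const_mul'' _ ((hKm k).const_add 1), lintegral_add_left measurable_const,
          lintegral_const, measure_univ, mul_one, hKint]
    _ < ∞ := by
        rw [ENNReal.tsum_add, ENNReal.tsum_mul_left]
        refine ENNReal.add_lt_top.2 ⟨ENNReal.add_lt_top.2 ⟨ENNReal.mul_lt_top ?_ hesum, he'sum⟩,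
          ENNReal.ofReal_lt_top⟩
        exact ENNReal.mul_lt_top hA.lt_top (ENNReal.add_lt_top.2 ⟨ENNReal.one_lt_top,
          ENNReal.mul_lt_top ENNReal.ofNat_lt_top hMtop.lt_top⟩)
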